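/- Let $(\mathfrak B,|\cdot|)$ be a (real or complex) Banach space and let $\mathcal A:D(\mathcal A)\to\mathfrak B$, $D(\mathcal A)\subseteq\mathfrak B$, be the infinitesimal generator of a $C_0$-semigroup $\{U(t)\}_{t\ge 0}$ on $\mathfrak B$. Assume that the semigroup is hyperbolic: there are a bounded linear projection $\mathcal P$ ($\mathcal P^2=\mathcal P$, $\mathcal Q:=I-\mathcal P$) and constants $\mathcal N,\nu>0$ such that, for all $t\ge 0$, $U(t)\mathcal P=\mathcal PU(t)$ and $U(t)$ maps $\operatorname{Im}\mathcal Q$ bijectively onto itself, and, for all $x\in\mathfrak B$, $|U(t)\mathcal Px|\le\mathcal Ne^{-\nu t}|x|$ for $t\ge0$ and $|U_{\mathcal Q}(t)x|\le \mathcal Ne^{\nu t}|x|$ for $t<0$, where $U_{\mathcal Q}(t):=\big(U(-t)|_{\operatorname{Im}\mathcal Q}\big)^{-1}\mathcal Q$. **Definitions.** Let $\mathbb T=\mathbb R$ or $\mathbb R_+=[0,\infty)$, let $(X,\rho)$ be a complete metric space, and let $C(\mathbb T,X)$ be the space of continuous functions with the compact-open topology, metrized by $d(\varphi,\psi)=\sup_{L>0}\min\{\max_{|t|\le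 L}\rho(\varphi(t),\psi(t)),L^{-1}\}$. Put $\varphi^h(t)=\varphi(t+h)$ for $t,h\in\mathbb T$. A set $S\subseteq\mathbb T$ is relatively dense if for some $l>0$ in $\mathbb T$ it meets $[a,a+l]$ for every $a\in\mathbb T$. For $\varphi\in C(\mathbb T,X)$ let $\mathcal T(\varphi,\varepsilon)=\{\tau\in\mathbb T:\rho(\varphi(t+\tau),\varphi(t))<\varepsilon\ \forall t\in\mathbb T\}$. The function $\varphi$ is - stationary if $\varphi(t)=\varphi(0)$, and $\tau$-periodic ($\tau\in\mathbb T$) if $\varphi(t+\tau)=\varphi(t)$, for all $t\in\mathbb T$; - quasi-periodic with the spectrum of frequencies $\nu_1,\dots,\nu_k$ if these real numbers are rationally independent and $\varphi(t)=\Phi(\nu_1t,\dots,\nu_kt)$ for all $t\in\mathbb T$, with a continuous $\Phi:\mathbb R^k\to X$ that is $2\pi$-periodic in each of its variables; - Bohr almost periodic if $\mathcal T(\varphi,\varepsilon)$ is relatively dense for every $\varepsilon>0$; - Lagrange stable if $\{\varphi^\tau:\tau\in\mathbb T\}$ is pre-compact in $C(\mathbb T,X)$; - Birkhoff recurrent if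 it is Lagrange stable and $\{\tau\in\mathbb T:d(\varphi^\tau,\varphi)<\varepsilon\}$ is relatively dense for every $\varepsilon>0$; - Levitan almost periodic if there are a complete metric space $Y$ and a Bohr almost periodic $\psi\in C(\mathbb T,Y)$ such that for every $\varepsilon>0$ there is $\delta>0$ with $d(\varphi^\tau,\varphi)<\varepsilon$ for all $\tau\in\mathcal T(\psi,\delta)$. A function in $C(\mathbb R,X)$ is almost automorphic if it is Levitan almost periodic and Lagrange stable (with $\mathbb T=\mathbb R$). A function $\varphi\in C(\mathbb R_+,X)$ is asymptotically stationary (respectively, asymptotically $\tau$-periodic, asymptotically quasi-periodic with the spectrum of frequencies $\nu_1,\dots,\nu_k$, asymptotically Bohr almost periodic, asymptotically Birkhoff recurrent) if there is a $p\in C(\mathbb R_+,X)$ with the corresponding property (with $\mathbb T=\mathbb R_+$) such that $\lim_{t\to+\infty}\rho(\varphi(t),p(t))=0$; it is asymptotically almost automorphic if there is an almost automorphic $p\in C(\mathbb R,X)$ such that $\lim_{t\to+\infty}\rho(\varphi(t),p(t))=0$. **Statement.** Let $f:\mathbb R_+\to\mathfrak B$ be continuous and bounded. Then the equation $x'=\mathcal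 Ax+f(t)$ has exactly one continuous bounded mild solution $\varphi:\mathbb R_+\to\mathfrak B$ with $\mathcal P\varphi(0)=0$, that is, exactly one such $\varphi$ with $$\varphi(t)=U(t)\varphi(0)+\int_0^tU(t-s)f(s)\,ds\qquad(t\ge0).$$ If $f$ is asymptotically stationary (respectively, asymptotically $\tau$-periodic, asymptotically quasi-periodic with the spectrum of frequencies $\nu_1,\dots,\nu_k$, asymptotically Bohr almost periodic, asymptotically almost automorphic, asymptotically Birkhoff recurrent, Lagrange stable), then so is $\varphi$ (with the same $\tau$, respectively the same $\nu_1,\dots,\nu_k$). -/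

import Mathlib

open Filter Topology Set
open scoped NNReal BoundedContinuousFunction

universe u v w

namespace AsymptoticRecurrence

section Recurrence

/- The time set `T` stands for `ℝ` or `ℝ≥0`; the definitions read the same for both.
The space `C(T, X)` carries Mathlib's compact-open topology. -/
variable {T : Type v} [AddCommMonoid T] [Preorder T] [PseudoMetricSpace T] [ContinuousAdd T]
variable {X : Type u} [MetricSpace X]

/-- The translate `φ^h`, `φ^h (t) = φ (h + t)`. -/
def shift (h : T) (φ : C(T, X)) : C(T, X) :=
  ⟨fun t => φ (h + t), φ.continuous.comp (continuous_const.add continuous_id)⟩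

/-- The distance `d(φ, ψ) = sup_{L > 0} min {max_{|t| ≤ L} ρ(φ(t), ψ(t)), 1 / L}`. -/
noncomputable def bebutovDist (φ ψ : C(T, X)) : ℝ :=
  ⨆ L : Ioi (0 : ℝ), min (⨆ t : Metric.closedBall (0 : T) (L : ℝ), dist (φ t) (ψ t)) (L : ℝ)⁻¹

/-- There is `l > 0` such that every segment `[a, a + l]` of `T` meets `S`. -/
def IsRelativelyDense (S : Set T) : Prop :=
  ∃ l : T, 0 < l ∧ ∀ a : T, (S ∩ Icc a (a + l)).Nonempty

/-- The set of `ε`-almost periods of `φ`. -/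
def almostPeriods (φ : C(T, X)) (ε : ℝ) : Set T :=
  {τ | ∀ t, dist (φ (t + τ)) (φ t) < ε}

def IsStationary (φ : C(T, X)) : Prop :=
  ∀ t, φ t = φ 0

def IsPeriodic (τ : T) (φ : C(T, X)) : Prop :=
  ∀ t, φ (t + τ) = φ t

def IsBohrAlmostPeriodic (φ : C(T, X)) : Prop :=
  ∀ ε : ℝ, 0 < ε → IsRelativelyDense (almostPeriods φ ε)

/-- The set of all translates is pre-compact in the compact-open topology. -/
def IsLagrangeStable (φ : C(T, X)) : Prop :=
  IsCompact (closure (range fun τ : T => shift τ φ))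

def IsAlmostRecurrent (φ : C(T, X)) : Prop :=
  ∀ ε : ℝ, 0 < ε → IsRelativelyDense {τ : T | bebutovDist (shift τ φ) φ < ε}

def IsBirkhoffRecurrent (φ : C(T, X)) : Prop :=
  IsAlmostRecurrent φ ∧ IsLagrangeStable φ

/-- There is a Bohr almost periodic function `ψ` with values in some complete metric space such
that for each `ε > 0` there is `δ > 0` for which every `δ`-almost period of `ψ` is an `ε`-shift
of `φ`. -/
def IsLevitanAlmostPeriodic (φ : C(T, X)) : Prop :=
  ∃ (Y : Type w) (_ : MetricSpace Y) (_ : CompleteSpace Y) (ψ : C(T, Y)),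
    IsBohrAlmostPeriodic ψ ∧
      ∀ ε : ℝ, 0 < ε → ∃ δ : ℝ, 0 < δ ∧ ∀ τ ∈ almostPeriods ψ δ, bebutovDist (shift τ φ) φ < ε

end Recurrence

section Asymptotic

variable {X : Type u} [MetricSpace X]

/-- Almost automorphic functions are defined on the whole real line. -/
def IsAlmostAutomorphic (φ : C(ℝ, X)) : Prop :=
  IsLevitanAlmostPeriodic.{u, 0, w} φ ∧ IsLagrangeStable φ

/-- Quasi-periodicity on the semi-axis with the spectrum of frequencies `ν₁, …, ν_k`: the
frequencies are rationally independent and `φ(t) = Φ(ν₁ t, …, ν_k t)` with `Φ` continuous and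
`2π`-periodic in each of its variables. -/
def IsQuasiPeriodic {k : ℕ} (ν : Fin k → ℝ) (φ : C(ℝ≥0, X)) : Prop :=
  LinearIndependent ℚ ν ∧
    ∃ Φ : (Fin k → ℝ) → X, Continuous Φ ∧
      (∀ (θ : Fin k → ℝ) (i : Fin k), Φ (Function.update θ i (θ i + 2 * Real.pi)) = Φ θ) ∧
      ∀ t : ℝ≥0, φ t = Φ fun i => ν i * (t : ℝ)

/-- `φ` is asymptotic, as `t → +∞`, to a function on the semi-axis with the property `R`. -/
def Asymptotically (R : C(ℝ≥0, X) → Prop) (φ : C(ℝ≥0, X)) : Prop :=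
  ∃ p : C(ℝ≥0, X), R p ∧ Tendsto (fun t : ℝ≥0 => dist (φ t) (p t)) atTop (𝓝 0)

/-- `φ` is asymptotic, as `t → +∞`, to an almost automorphic function. -/
def IsAsymptoticallyAlmostAutomorphic (φ : C(ℝ≥0, X)) : Prop :=
  ∃ p : C(ℝ, X), IsAlmostAutomorphic.{u, w} p ∧
    Tendsto (fun t : ℝ≥0 => dist (φ t) (p (t : ℝ))) atTop (𝓝 0)

end Asymptotic

section Semigroup

variable (𝕜 : Type v) [RCLike 𝕜]
variable (𝔅 : Type u) [NormedAddCommGroup 𝔅] [NormedSpace ℝ 𝔅] [NormedSpace 𝕜 𝔅]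

/-- A strongly continuous one-parameter semigroup of bounded linear operators. -/
structure C0Semigroup where
  op : ℝ≥0 → 𝔅 →L[𝕜] 𝔅
  op_zero : op 0 = ContinuousLinearMap.id 𝕜 𝔅
  op_add : ∀ s t : ℝ≥0, op (s + t) = (op s).comp (op t)
  continuous_orbit : ∀ x : 𝔅, Continuous fun t : ℝ≥0 => op t x

variable {𝕜 𝔅}

/-- `A` is the infinitesimal generator of `U`: `x ∈ D(A)` and `A x = y` if and only if
`(U(h) x - x) / h → y` as `h → 0+`. -/
def IsGenerator (A : 𝔅 →ₗ.[𝕜] 𝔅) (U : C0Semigroup 𝕜 𝔅) : Prop :=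
  ∀ x y : 𝔅, (x, y) ∈ A.graph ↔
    Tendsto (fun h : ℝ≥0 => (h : ℝ)⁻¹ • (U.op h x - x)) (𝓝[>] 0) (𝓝 y)

/-- `U_Q(t)`, for `t < 0`: the inverse of the restriction of `U(-t)` to the image of `Q`,
applied after `Q`. -/
noncomputable def unstableInverse (U : C0Semigroup 𝕜 𝔅) (Q : 𝔅 →L[𝕜] 𝔅) (t : ℝ) (x : 𝔅) : 𝔅 :=
  Function.invFunOn (U.op (Real.toNNReal (-t))) (range Q) (Q x)

/-- The semigroup `U` is hyperbolic with the projection `P`; here `Q = I - P`. -/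
structure IsHyperbolic (U : C0Semigroup 𝕜 𝔅) (P : 𝔅 →L[𝕜] 𝔅) : Prop where
  proj : ∀ x, P (P x) = P x
  comm : ∀ (t : ℝ≥0) (x : 𝔅), U.op t (P x) = P (U.op t x)
  bijOn : ∀ t : ℝ≥0, BijOn (U.op t) (range (ContinuousLinearMap.id 𝕜 𝔅 - P))
    (range (ContinuousLinearMap.id 𝕜 𝔅 - P))
  dichotomy : ∃ N ν : ℝ, 0 < N ∧ 0 < ν ∧
    (∀ (t : ℝ≥0) (x : 𝔅), ‖U.op t (P x)‖ ≤ N * Real.exp (-ν * t) * ‖x‖) ∧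
    (∀ t : ℝ, t < 0 → ∀ x : 𝔅,
      ‖unstableInverse U (ContinuousLinearMap.id 𝕜 𝔅 - P) t x‖ ≤ N * Real.exp (ν * t) * ‖x‖)

/-- `φ` is a mild solution on the semi-axis of `x' = A x + f(t)`, where `A` generates `U`:
`φ(t) = U(t) φ(0) + ∫₀ᵗ U(t - s) f(s) ds` for all `t ≥ 0`. -/
def IsMildSolution (U : C0Semigroup 𝕜 𝔅) (f φ : C(ℝ≥0, 𝔅)) : Prop :=
  ∀ t : ℝ≥0, φ t = U.op t (φ 0) +
    ∫ s in (0 : ℝ)..(t : ℝ), U.op (Real.toNNReal ((t : ℝ) - s)) (f (Real.toNNReal s))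

end Semigroup

end AsymptoticRecurrence

/-!
The bounded solution is an integral against a Green kernel. Let `G(s) = U(s) P` for `s ≥ 0` and
`G(s) = -U_Q(s)` for `s < 0`. By hyperbolicity `‖G(s)‖` is dominated by a multiple of
`exp (-ν |s|)`, so `Γ g (t) = ∫ G(s) g(t - s) ds` is defined for every bounded continuous
`g : ℝ → 𝔅`. Since `G(t - r) - U(t) G(-r)` equals `U(t - r)` for `0 < r ≤ t` and vanishes otherwise
(`IsHyperbolic.green_sub`), `Γ g` is a mild solution with forcing term `g`. For `f` on the semi-axis,
extended to the line by the constant `f(0)`, the wanted solution is `Γ f (t) - U(t) P Γ f (0)`. It is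
unique because a bounded orbit in the unstable subspace is zero.

The operator `Γ` commutes with translations, and on a set of uniformly bounded functions it is
continuous in the compact-open topology (`IsDominatedKernel.continuous_conv`, by dominated
convergence). So it carries hulls to hulls, near-returns to near-returns and almost periods to
almost periods. By dominated convergence again, `Γ f - Γ g` tends to `0` at `+∞` as soon as `f - g`
does (`IsDominatedKernel.tendsto_conv_sub`). It therefore suffices to replace the function `p` on
the semi-axis to which `f` is asymptotic by a bounded function on the line with the same recurrence,
which equals `p` on the semi-axis.

For stationary and quasi-periodic `p` such an extension is explicit, and almost automorphic
functions live on the line from the start. The other classes reduce to Birkhoff recurrence: a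
periodic function of positive period is Bohr almost periodic, and a Bohr almost periodic function is
Birkhoff recurrent. A Birkhoff recurrent `p` extends to the line as a limit of translates of `p`
along a filter of times tending to `+∞` for which the translates return to `p`
(`IsBirkhoffRecurrent.exists_extension`); the hull being compact, the limit exists.
-/

namespace AsymptoticRecurrence

/-! ### The compact-open topology and the Bebutov distance -/

section Bebutov

variable {T : Type v} [AddCommMonoid T] [PseudoMetricSpace T]
variable {X : Type u} [MetricSpace X]

theorem bebutovDist_lt {φ ψ : C(T, X)} {ε δ L : ℝ} (hL : 0 < L) (hLε : L⁻¹ < ε) (hδε : δ < ε)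
    (h : ∀ t ∈ Metric.closedBall (0 : T) L, dist (φ t) (ψ t) ≤ δ) : bebutovDist φ ψ < ε := by
  have : Nonempty (Ioi (0 : ℝ)) := ⟨⟨1, mem_Ioi.2 one_pos⟩⟩
  refine (ciSup_le fun L' : Ioi (0 : ℝ) => ?_).trans_lt (max_lt hδε hLε)
  obtain ⟨L', hL'⟩ := L'
  have : Nonempty (Metric.closedBall (0 : T) L') := ⟨⟨0, Metric.mem_closedBall_self (le_of_lt hL')⟩⟩
  rcases le_total L' L with hle | hle
  · exact (min_le_left _ _).trans ((ciSup_le fun t : Metric.closedBall (0 : T) L' =>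
      h t (Metric.closedBall_subset_closedBall hle t.2)).trans (le_max_left _ _))
  · exact (min_le_right _ _).trans ((inv_anti₀ hL hle).trans (le_max_right _ _))

variable [ProperSpace T]

theorem bddAbove_range_dist (φ ψ : C(T, X)) (L : ℝ) :
    BddAbove (range fun t : Metric.closedBall (0 : T) L => dist (φ t) (ψ t)) := by
  have h := (isCompact_closedBall (0 : T) L).bddAbove_image
    (f := fun t => dist (φ t) (ψ t)) (by fun_prop)
  rwa [image_eq_range] at h

theorem dist_lt_of_bebutovDist_lt {φ ψ : C(T, X)} {ε L : ℝ} (hL : 0 < L)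
    (h : bebutovDist φ ψ < min ε L⁻¹) {t : T} (ht : t ∈ Metric.closedBall (0 : T) L) :
    dist (φ t) (ψ t) < ε := by
  have hbdd : BddAbove (range fun L : Ioi (0 : ℝ) =>
      min (⨆ t : Metric.closedBall (0 : T) (L : ℝ), dist (φ t) (ψ t)) (L : ℝ)⁻¹) := by
    -- Terms with `L' ≤ 1` are bounded by the supremum over the unit ball, the others by `1`.
    refine ⟨max (⨆ t : Metric.closedBall (0 : T) (1 : ℝ), dist (φ t) (ψ t)) 1, ?_⟩
    rintro _ ⟨⟨L', hL'⟩, rfl⟩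
    have : Nonempty (Metric.closedBall (0 : T) L') :=
      ⟨⟨0, Metric.mem_closedBall_self (le_of_lt hL')⟩⟩
    rcases le_total L' 1 with hle | hle
    · exact (min_le_left _ _).trans ((ciSup_le fun t : Metric.closedBall (0 : T) L' =>
        le_ciSup (bddAbove_range_dist φ ψ 1) ⟨t.1,
          Metric.closedBall_subset_closedBall hle t.2⟩).trans (le_max_left _ _))
    · exact (min_le_right _ _).trans ((inv_le_one_of_one_le₀ hle).trans (le_max_right _ _))
  have h1 := (le_ciSup hbdd ⟨L, hL⟩).trans_lt h
  have h2 : (⨆ t : Metric.closedBall (0 : T) L, dist (φ t) (ψ t)) < ε := by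
    by_contra! hc
    exact absurd h1 (not_lt.2 (min_le_min_right _ hc))
  exact (le_ciSup (bddAbove_range_dist φ ψ L) ⟨t, ht⟩).trans_lt h2

theorem hasBasis_nhds_dist (φ : C(T, X)) :
    (𝓝 φ).HasBasis (fun p : ℝ × ℝ => 0 < p.1 ∧ 0 < p.2)
      fun p => {ψ | ∀ t ∈ Metric.closedBall (0 : T) p.1, dist (ψ t) (φ t) < p.2} := by
  refine (nhds_basis_uniformity'
    (Metric.uniformity_basis_dist.compactConvergenceUniformity (α := T))).to_hasBasis ?_ ?_
  · rintro ⟨K, ε⟩ ⟨hK, hε⟩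
    obtain ⟨r, hr⟩ := hK.isBounded.subset_closedBall (0 : T)
    refine ⟨(max r 1, ε), ⟨by positivity, hε⟩, fun ψ hψ t ht => ?_⟩
    have := hψ t (Metric.closedBall_subset_closedBall (le_max_left r 1) (hr ht))
    rwa [dist_comm] at this
  · rintro ⟨L, ε⟩ ⟨hL, hε⟩
    refine ⟨(Metric.closedBall 0 L, ε), ⟨isCompact_closedBall _ _, hε⟩, fun ψ hψ t ht => ?_⟩
    have : dist (φ t) (ψ t) < ε := hψ t ht
    rwa [dist_comm] at this

theorem hasBasis_nhds_bebutovDist (φ : C(T, X)) :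
    (𝓝 φ).HasBasis (fun ε : ℝ => 0 < ε) fun ε => {ψ | bebutovDist ψ φ < ε} := by
  refine (hasBasis_nhds_dist φ).to_hasBasis ?_ ?_
  · rintro ⟨L, ε⟩ ⟨hL, hε⟩
    exact ⟨min ε L⁻¹, lt_min hε (inv_pos.2 hL), fun ψ hψ t ht => dist_lt_of_bebutovDist_lt hL hψ ht⟩
  · intro ε hε
    have hL : (2 / ε)⁻¹ < ε := by rw [inv_div]; linarith
    exact ⟨(2 / ε, ε / 2), ⟨by positivity, by positivity⟩, fun ψ hψ =>
      bebutovDist_lt (by positivity) hL (half_lt_self hε) fun t ht => (hψ t ht).le⟩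

end Bebutov

/-! ### Functions on the semi-axis and on the line -/

section HalfLine

variable {X : Type u} [MetricSpace X]

/-- The restriction of a function on the line to the semi-axis. -/
def restrictHalf (g : C(ℝ, X)) : C(ℝ≥0, X) :=
  g.comp ⟨fun t : ℝ≥0 => (t : ℝ), NNReal.continuous_coe⟩

/-- The extension of a function on the semi-axis to the line by its value at `0`. -/
noncomputable def extendHalf (g : C(ℝ≥0, X)) : C(ℝ, X) :=
  g.comp ⟨Real.toNNReal, continuous_real_toNNReal⟩

@[simp] theorem restrictHalf_apply (g : C(ℝ, X)) (t : ℝ≥0) : restrictHalf g t = g t := rfl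

@[simp] theorem extendHalf_apply (g : C(ℝ≥0, X)) (t : ℝ) : extendHalf g t = g t.toNNReal := rfl

@[simp] theorem shift_apply {T : Type v} [AddCommMonoid T] [PseudoMetricSpace T] [ContinuousAdd T]
    (h : T) (g : C(T, X)) (t : T) : shift h g t = g (h + t) := rfl

theorem restrictHalf_extendHalf (g : C(ℝ≥0, X)) : restrictHalf (extendHalf g) = g := by
  ext t; simp

theorem shift_restrictHalf (g : C(ℝ, X)) (τ : ℝ≥0) :
    shift τ (restrictHalf g) = restrictHalf (shift (τ : ℝ) g) := by
  ext t; simp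

theorem continuous_restrictHalf : Continuous (restrictHalf : C(ℝ, X) → C(ℝ≥0, X)) :=
  ContinuousMap.continuous_precomp _

theorem IsLagrangeStable.exists_isCompact {T : Type v} [AddCommMonoid T] [PseudoMetricSpace T]
    [ContinuousAdd T] {φ : C(T, X)} (h : IsLagrangeStable φ) : ∃ K, IsCompact K ∧ ∀ t, φ t ∈ K :=
  ⟨_, h.image (continuous_eval_const (0 : T)), fun t =>
    ⟨shift t φ, subset_closure ⟨t, rfl⟩, by simp⟩⟩

/-- The evaluation map is uniformly continuous on the product of the compact hull with a compact
time interval. -/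
theorem IsLagrangeStable.uniformContinuous {φ : C(ℝ≥0, X)} (h : IsLagrangeStable φ) :
    UniformContinuous φ := by
  have hK : IsCompact (closure (range fun τ : ℝ≥0 => shift τ φ) ×ˢ Icc (0 : ℝ≥0) 1) :=
    h.prod isCompact_Icc
  have huc := hK.uniformContinuousOn_of_continuous
    (f := fun p : C(ℝ≥0, X) × ℝ≥0 => p.1 p.2) (by fun_prop)
  rw [Metric.uniformContinuous_iff]
  intro ε hε
  have hV := huc (Metric.dist_mem_uniformity hε)
  rw [mem_map, mem_inf_principal, uniformity_prod, mem_inf_iff_superset] at hV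
  obtain ⟨V₁, hV₁, V₂, hV₂, hsub⟩ := hV
  obtain ⟨W₁, hW₁, hW₁V⟩ := mem_comap.1 hV₁
  obtain ⟨W₂, hW₂, hW₂V⟩ := mem_comap.1 hV₂
  obtain ⟨δ, hδ, hδW⟩ := Metric.mem_uniformity_dist.1 hW₂
  have key : ∀ s t : ℝ≥0, s ≤ t → dist s t < min δ 1 → dist (φ s) (φ t) < ε := by
    intro s t hst hd
    have hd' : dist (0 : ℝ≥0) (t - s) = dist s t := by
      rw [NNReal.dist_eq, NNReal.dist_eq, NNReal.coe_sub hst]; simp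
    have h1 : t - s ≤ 1 := by
      rw [← NNReal.coe_le_coe]
      have := (hd'.trans_lt hd).le.trans (min_le_right _ _)
      rw [NNReal.dist_eq] at this
      simpa using (abs_le.1 this).1
    have := hsub ⟨hW₁V (a := ((shift s φ, 0), (shift s φ, t - s))) (refl_mem_uniformity hW₁),
      hW₂V (a := ((shift s φ, 0), (shift s φ, t - s)))
        (hδW (by rw [hd']; exact hd.trans_le (min_le_left _ _)))⟩
      ⟨⟨subset_closure ⟨s, rfl⟩, by simp⟩, ⟨subset_closure ⟨s, rfl⟩, by simp [h1]⟩⟩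
    simpa [add_tsub_cancel_of_le hst] using this
  refine ⟨min δ 1, by positivity, fun {s t} hd => ?_⟩
  rcases le_total s t with hst | hst
  · exact key s t hst hd
  · rw [dist_comm] at hd ⊢
    exact key t s hst hd

/-- This is the Arzelà–Ascoli theorem: the translates of a uniformly continuous function are
equicontinuous. -/
theorem isLagrangeStable_of_uniformContinuous [CompleteSpace X] {g : C(ℝ, X)}
    (hg : UniformContinuous g) {K : Set X} (hK : IsCompact K) (hgK : ∀ t, g t ∈ K) :
    IsLagrangeStable g := by
  have : T2Space (UniformOnFun ℝ X {K | IsCompact K}) := UniformOnFun.t2Space_of_covering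
    (eq_univ_of_forall fun x => mem_sUnion_of_mem (mem_singleton x) isCompact_singleton)
  refine ArzelaAscoli.isCompact_closure_of_isClosedEmbedding
    (F := fun φ : C(ℝ, X) => (φ : ℝ → X)) (𝔖 := {K | IsCompact K}) (fun _ h => h)
    ContinuousMap.isUniformEmbedding_toUniformOnFunIsCompact.isClosedEmbedding
    (fun K' _ => ?_) (fun _ _ x _ => ⟨K, hK, ?_⟩)
  · refine (UniformEquicontinuous.equicontinuous ?_).equicontinuousOn K'
    rw [Metric.uniformEquicontinuous_iff]
    intro ε hε
    obtain ⟨δ, hδ, hd⟩ := Metric.uniformContinuous_iff.1 hg ε hε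
    refine ⟨δ, hδ, fun s t hst ⟨_, τ, rfl⟩ => hd ?_⟩
    simpa using hst
  · rintro _ ⟨τ, rfl⟩
    exact hgK _

theorem IsLagrangeStable.extendHalf [CompleteSpace X] {φ : C(ℝ≥0, X)} (h : IsLagrangeStable φ) :
    IsLagrangeStable (extendHalf φ) := by
  obtain ⟨K, hK, hφ⟩ := h.exists_isCompact
  exact isLagrangeStable_of_uniformContinuous
    (h.uniformContinuous.comp Real.lipschitzWith_toNNReal.uniformContinuous) hK fun t => hφ _

theorem IsLagrangeStable.restrictHalf {g : C(ℝ, X)} (h : IsLagrangeStable g) :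
    IsLagrangeStable (restrictHalf g) := by
  refine (h.image continuous_restrictHalf).closure_of_subset ?_
  rintro _ ⟨τ, rfl⟩
  exact ⟨shift (τ : ℝ) g, subset_closure ⟨_, rfl⟩, (shift_restrictHalf g τ).symm⟩

end HalfLine

/-! ### Recurrence on the semi-axis and extension to the line -/

section Extension

variable {X : Type u} [MetricSpace X]

theorem IsRelativelyDense.mono {T : Type v} [AddCommMonoid T] [Preorder T] {S S' : Set T}
    (h : IsRelativelyDense S) (hS : S ⊆ S') : IsRelativelyDense S' := by
  obtain ⟨l, hl, h⟩ := h
  exact ⟨l, hl, fun a => (h a).mono (inter_subset_inter_left _ hS)⟩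

theorem IsRelativelyDense.add_left {S : Set ℝ≥0} (h : IsRelativelyDense S) (c : ℝ≥0) :
    IsRelativelyDense ((fun τ => c + τ) '' S) := by
  obtain ⟨l, hl, h⟩ := h
  refine ⟨c + l, by positivity, fun a => ?_⟩
  obtain ⟨τ, hτ, h1, h2⟩ := h a
  refine ⟨c + τ, ⟨τ, hτ, rfl⟩, h1.trans le_add_self, ?_⟩
  calc c + τ ≤ c + (a + l) := by gcongr
    _ = a + (c + l) := by ring

theorem IsRelativelyDense.frequently {S : Set ℝ≥0} (h : IsRelativelyDense S) :
    ∃ᶠ τ in atTop, τ ∈ S := by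
  obtain ⟨l, _, h⟩ := h
  exact frequently_atTop.2 fun a => let ⟨τ, hτ, h1, _⟩ := h a; ⟨τ, h1, hτ⟩

/-- Every point of the semi-axis is moved into a fixed segment by subtracting an almost period, so
that the values are close to those on the segment. -/
theorem IsBohrAlmostPeriodic.exists_segment {φ : C(ℝ≥0, X)} (h : IsBohrAlmostPeriodic φ) {ε : ℝ}
    (hε : 0 < ε) : ∃ l : ℝ≥0, ∀ t : ℝ≥0, ∃ s τ : ℝ≥0, s ≤ l ∧ t = s + τ ∧
      τ ∈ almostPeriods φ ε := by
  obtain ⟨l, hl, h⟩ := h ε hε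
  refine ⟨l, fun t => ?_⟩
  rcases le_total t l with htl | htl
  · exact ⟨t, 0, htl, by simp, fun s => by simpa using hε⟩
  · obtain ⟨τ, hτ, h1, h2⟩ := h (t - l)
    rw [tsub_add_cancel_of_le htl] at h2
    exact ⟨t - τ, τ, tsub_le_iff_tsub_le.1 h1, (tsub_add_cancel_of_le h2).symm, hτ⟩

theorem IsBohrAlmostPeriodic.uniformContinuous {φ : C(ℝ≥0, X)} (h : IsBohrAlmostPeriodic φ) :
    UniformContinuous φ := by
  rw [Metric.uniformContinuous_iff]
  intro ε hε
  obtain ⟨l, hl⟩ := h.exists_segment (show 0 < ε / 3 by positivity)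
  obtain ⟨δ, hδ, hd⟩ := Metric.uniformContinuousOn_iff.1
    ((isCompact_Icc (a := (0 : ℝ≥0)) (b := l + 1)).uniformContinuousOn_of_continuous
      φ.continuous.continuousOn) (ε / 3) (by positivity)
  have key : ∀ s t : ℝ≥0, s ≤ t → dist s t < min δ 1 → dist (φ s) (φ t) < ε := by
    intro s t hst hdist
    obtain ⟨s', τ, hs', rfl, hτ⟩ := hl s
    obtain ⟨r, rfl⟩ := exists_add_of_le hst
    have hr : dist s' (s' + r) = dist (s' + τ) (s' + τ + r) := by
      simp [NNReal.dist_eq]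
    have hr1 : r ≤ 1 := by
      have := (hr.trans_lt hdist).le.trans (min_le_right _ _)
      rw [NNReal.dist_eq] at this
      simpa using this
    have h1 := hτ s'
    have h2 := hτ (s' + r)
    have h3 := hd s' ⟨zero_le, hs'.trans le_self_add⟩ (s' + r) ⟨zero_le, add_le_add hs' hr1⟩
      ((hr.trans_lt hdist).trans_le (min_le_left _ _))
    rw [dist_comm] at h2
    rw [show s' + r + τ = s' + τ + r by ring] at h2
    linarith [dist_triangle4 (φ (s' + τ)) (φ s') (φ (s' + r)) (φ (s' + τ + r))]
  refine ⟨min δ 1, by positivity, fun {s t} hst => ?_⟩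
  rcases le_total s t with hle | hle
  · exact key s t hle hst
  · rw [dist_comm] at hst ⊢
    exact key t s hle hst

theorem IsBohrAlmostPeriodic.totallyBounded_range {φ : C(ℝ≥0, X)} (h : IsBohrAlmostPeriodic φ) :
    TotallyBounded (range φ) := by
  rw [Metric.totallyBounded_iff]
  intro ε hε
  obtain ⟨l, hl⟩ := h.exists_segment (show 0 < ε / 2 by positivity)
  obtain ⟨F, hF, hcov⟩ := Metric.totallyBounded_iff.1
    ((isCompact_Icc (a := (0 : ℝ≥0)) (b := l)).image φ.continuous).totallyBounded (ε / 2)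
      (by positivity)
  refine ⟨F, hF, ?_⟩
  rintro _ ⟨t, rfl⟩
  obtain ⟨s, τ, hs, rfl, hτ⟩ := hl t
  obtain ⟨y, hy, hsy⟩ := mem_iUnion₂.1 (hcov ⟨s, ⟨zero_le, hs⟩, rfl⟩)
  refine mem_iUnion₂.2 ⟨y, hy, ?_⟩
  have h1 := hτ s
  rw [Metric.mem_ball] at hsy ⊢
  linarith [dist_triangle (φ (s + τ)) (φ s) y]

theorem IsBohrAlmostPeriodic.isBirkhoffRecurrent [CompleteSpace X] {φ : C(ℝ≥0, X)}
    (h : IsBohrAlmostPeriodic φ) : IsBirkhoffRecurrent φ := by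
  refine ⟨fun ε hε => (h (ε / 2) (by positivity)).mono fun τ hτ => ?_, ?_⟩
  · refine bebutovDist_lt (L := 2 / ε) (by positivity) (by rw [inv_div]; linarith)
      (half_lt_self hε) fun t _ => ?_
    simpa [add_comm] using (hτ t).le
  · rw [← restrictHalf_extendHalf φ]
    refine IsLagrangeStable.restrictHalf (isLagrangeStable_of_uniformContinuous
      (h.uniformContinuous.comp Real.lipschitzWith_toNNReal.uniformContinuous)
      (isCompact_iff_totallyBounded_isComplete.2
        ⟨h.totallyBounded_range.closure, isClosed_closure.isComplete⟩)
      fun t => subset_closure (mem_range_self _))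

theorem IsPeriodic.isBohrAlmostPeriodic {φ : C(ℝ≥0, X)} {τ : ℝ≥0} (hτ : 0 < τ)
    (h : IsPeriodic τ φ) : IsBohrAlmostPeriodic φ := by
  have hper : Function.Periodic φ τ := h
  refine fun ε hε => ⟨τ, hτ, fun a => ?_⟩
  refine ⟨⌈a / τ⌉₊ * τ, fun t => ?_, ?_, ?_⟩
  · rw [← nsmul_eq_mul, hper.nsmul]
    simpa using hε
  · exact (div_le_iff₀ hτ).1 (Nat.le_ceil _)
  · have := (Nat.ceil_lt_add_one (zero_le (a := a / τ))).le
    calc (⌈a / τ⌉₊ : ℝ≥0) * τ ≤ (a / τ + 1) * τ := by gcongr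
      _ = a + τ := by rw [add_mul, div_mul_cancel₀ _ hτ.ne', one_mul]

/-- A Birkhoff recurrent function on the semi-axis extends to the line as a limit of its own
translates. Along some filter of times tending to infinity the translates return to the function
on the semi-axis, and by compactness a finer filter makes them converge on the whole line. -/
theorem IsBirkhoffRecurrent.exists_extension [CompleteSpace X] {φ : C(ℝ≥0, X)}
    (h : IsBirkhoffRecurrent φ) : ∃ g : C(ℝ, X), restrictHalf g = φ ∧ IsLagrangeStable g ∧
      ∃ F : Filter ℝ≥0, F.NeBot ∧ F ≤ atTop ∧
        Tendsto (fun τ : ℝ≥0 => shift (τ : ℝ) (extendHalf φ)) F (𝓝 g) := by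
  have hne : (atTop ⊓ comap (fun τ : ℝ≥0 => shift τ φ) (𝓝 φ)).NeBot := by
    rw [(atTop_basis.inf ((hasBasis_nhds_bebutovDist φ).comap _)).neBot_iff]
    rintro ⟨a, ε⟩ ⟨_, hε⟩
    obtain ⟨τ, hτ, hτ'⟩ := frequently_atTop.1 (h.1 ε hε).frequently a
    exact ⟨τ, hτ, hτ'⟩
  let F := Ultrafilter.of (atTop ⊓ comap (fun τ : ℝ≥0 => shift τ φ) (𝓝 φ))
  have hF : (F : Filter ℝ≥0) ≤ atTop ⊓ comap (fun τ : ℝ≥0 => shift τ φ) (𝓝 φ) :=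
    Ultrafilter.of_le _
  have hcomp : IsCompact (closure (range fun τ : ℝ => shift τ (extendHalf φ))) := h.2.extendHalf
  obtain ⟨g, hgH, hg⟩ := hcomp.ultrafilter_le_nhds
    (F.map fun τ : ℝ≥0 => shift (τ : ℝ) (extendHalf φ))
    (le_principal_iff.2 (mem_map.2 (univ_mem' fun τ => subset_closure ⟨_, rfl⟩)))
  refine ⟨g, ?_, ?_, F, inferInstance, hF.trans inf_le_left, hg⟩
  swap
  · -- The hull of `extendHalf φ` is invariant under translations, so it contains those of `g`.
    refine hcomp.closure_of_subset ?_
    rintro _ ⟨σ, rfl⟩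
    refine map_mem_closure (f := fun ψ : C(ℝ, X) => shift σ ψ)
      (ContinuousMap.continuous_precomp (⟨fun t => σ + t, by fun_prop⟩ : C(ℝ, ℝ))) hgH ?_
    rintro _ ⟨τ, rfl⟩
    exact ⟨τ + σ, by ext t; simp [add_assoc]⟩
  ext t
  have h1 : Tendsto (fun τ : ℝ≥0 => shift τ φ t) F (𝓝 (φ t)) :=
    ((continuous_eval_const t).tendsto φ).comp
      (tendsto_iff_comap.2 (hF.trans inf_le_right))
  have h2 : Tendsto (fun τ : ℝ≥0 => shift (τ : ℝ) (extendHalf φ) (t : ℝ)) F (𝓝 (g t)) :=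
    ((continuous_eval_const (t : ℝ)).tendsto g).comp hg
  refine tendsto_nhds_unique (h2.congr fun τ => ?_) h1
  simp [← NNReal.coe_add]

/-- Near-returns of `φ` after a long time become near-returns of the extension `g` on a two-sided
neighbourhood of `0`: the values of `g` on `[-L, L]` are copied by `φ` around some time `τ₀ ≥ L`. -/
theorem IsAlmostRecurrent.isRelativelyDense_extension {φ : C(ℝ≥0, X)} (h : IsAlmostRecurrent φ)
    {g : C(ℝ, X)} (hg : restrictHalf g = φ) {F : Filter ℝ≥0} [F.NeBot] (hF : F ≤ atTop)
    (hlim : Tendsto (fun τ : ℝ≥0 => shift (τ : ℝ) (extendHalf φ)) F (𝓝 g))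
    {V : Set C(ℝ, X)} (hV : V ∈ 𝓝 g) :
    IsRelativelyDense {τ : ℝ≥0 | shift (τ : ℝ) g ∈ V} := by
  obtain ⟨⟨L, ε⟩, ⟨hL, hε⟩, hLV⟩ := (hasBasis_nhds_dist g).mem_iff.1 hV
  simp only at hL hε hLV
  have hgφ : ∀ t : ℝ, 0 ≤ t → g t = φ t.toNNReal := by
    intro t ht
    rw [← hg]; simp [ht]
  obtain ⟨τ₀, hτ₀, hLτ₀⟩ := ((hlim.eventually ((hasBasis_nhds_dist g).mem_of_mem
    (i := (L, ε / 2)) ⟨hL, half_pos hε⟩)).and (hF (eventually_ge_atTop L.toNNReal))).exists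
  have hLτ : L ≤ τ₀ := Real.toNNReal_le_iff_le_coe.1 hLτ₀
  have hR : (0 : ℝ) < τ₀ + L := by positivity
  refine ((h (min (ε / 2) (τ₀ + L : ℝ)⁻¹) (by positivity)).add_left τ₀).mono ?_
  rintro _ ⟨σ, hσ, rfl⟩
  refine hLV fun t ht => ?_
  have ht' : |t| ≤ L := by simpa using ht
  obtain ⟨ht1, ht2⟩ := abs_le.1 ht'
  have h1 := hτ₀ t ht
  have h2 := dist_lt_of_bebutovDist_lt hR hσ (t := (τ₀ + t).toNNReal) (by
    rw [Metric.mem_closedBall, NNReal.dist_eq, Real.coe_toNNReal _ (by linarith), NNReal.coe_zero,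
      sub_zero, abs_of_nonneg (by linarith)]
    linarith)
  have h3 : shift ((τ₀ + σ : ℝ≥0) : ℝ) g t = shift σ φ (τ₀ + t : ℝ).toNNReal := by
    rw [shift_apply, hgφ _ (by push_cast; nlinarith [σ.2]), shift_apply]
    congr 1
    rw [NNReal.coe_add, add_comm (τ₀ : ℝ) σ, add_assoc,
      Real.toNNReal_add σ.coe_nonneg (by linarith), Real.toNNReal_coe]
  rw [h3]
  rw [shift_apply, extendHalf_apply] at h1
  linarith [dist_triangle (shift σ φ (τ₀ + t : ℝ).toNNReal) (φ (τ₀ + t : ℝ).toNNReal) (g t)]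

/-- Almost periods of `φ` remain almost periods of the extension obtained as a limit of
translates. -/
theorem dist_extension_le {φ : C(ℝ≥0, X)} {g : C(ℝ, X)} {F : Filter ℝ≥0} [F.NeBot]
    (hF : F ≤ atTop) (hlim : Tendsto (fun τ : ℝ≥0 => shift (τ : ℝ) (extendHalf φ)) F (𝓝 g))
    {σ : ℝ≥0} {δ : ℝ} (hσ : ∀ t, dist (φ (t + σ)) (φ t) ≤ δ) (t : ℝ) :
    dist (g (t + σ)) (g t) ≤ δ := by
  have hev : ∀ s : ℝ, Tendsto (fun τ : ℝ≥0 => φ (τ + s : ℝ).toNNReal) F (𝓝 (g s)) := fun s =>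
    ((continuous_eval_const s).tendsto g).comp hlim
  refine le_of_tendsto ((hev (t + σ)).dist (hev t)) ?_
  filter_upwards [hF (eventually_ge_atTop (-t).toNNReal)] with τ hτ
  have hτt : 0 ≤ (τ : ℝ) + t := by linarith [Real.toNNReal_le_iff_le_coe.1 hτ]
  have := hσ (τ + t : ℝ).toNNReal
  rwa [show (τ + t : ℝ).toNNReal + σ = (τ + (t + σ) : ℝ).toNNReal by
    rw [← add_assoc (τ : ℝ), Real.toNNReal_add hτt σ.coe_nonneg, Real.toNNReal_coe]] at this

end Extension

/-! ### Convolution with an operator-valued kernel -/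

section Kernel

open MeasureTheory

variable {𝕜 : Type v} [RCLike 𝕜]
variable {𝔅 : Type u} [NormedAddCommGroup 𝔅] [NormedSpace 𝕜 𝔅]

/-- The set of continuous functions on the line bounded by `M`, with the compact-open topology. -/
abbrev BoundedBy (𝔅 : Type u) [NormedAddCommGroup 𝔅] (M : ℝ) : Type u :=
  {g : C(ℝ, 𝔅) // ∀ t, ‖g t‖ ≤ M}

/-- The set of functions bounded by `M` is invariant under translations. -/
def BoundedBy.shift {M : ℝ} (h : ℝ) (g : BoundedBy 𝔅 M) : BoundedBy 𝔅 M :=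
  ⟨AsymptoticRecurrence.shift h g.1, fun _ => g.2 _⟩

/-- An operator-valued kernel dominated by the integrable function `b`. -/
structure IsDominatedKernel (G : ℝ → 𝔅 →L[𝕜] 𝔅) (b : ℝ → ℝ) : Prop where
  integrable : Integrable b
  norm_le : ∀ s x, ‖G s x‖ ≤ b s * ‖x‖
  aestronglyMeasurable : ∀ u : ℝ → 𝔅, Continuous u → AEStronglyMeasurable fun s => G s (u s)

namespace IsDominatedKernel

variable {G : ℝ → 𝔅 →L[𝕜] 𝔅} {b : ℝ → ℝ} {M : ℝ}

theorem norm_apply_le (hG : IsDominatedKernel G b) (g : BoundedBy 𝔅 M) (s t : ℝ) :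
    ‖G s (g.1 t)‖ ≤ |b s| * M := by
  have hM : 0 ≤ M := (norm_nonneg _).trans (g.2 0)
  exact (hG.norm_le s _).trans (mul_le_mul (le_abs_self _) (g.2 t) (norm_nonneg _) (abs_nonneg _))

theorem integrable_conv (hG : IsDominatedKernel G b) (g : BoundedBy 𝔅 M) (t : ℝ) :
    Integrable fun s => G s (g.1 (t - s)) :=
  (hG.integrable.abs.mul_const M).mono' (hG.aestronglyMeasurable _ (by fun_prop))
    (ae_of_all _ fun s => hG.norm_apply_le g s (t - s))

variable [NormedSpace ℝ 𝔅]

/-- The convolution is jointly continuous in the function and in time. This one fact, with the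
compact-open topology on a bounded set of functions, carries compactness and recurrence from `g` to
its convolution. -/
theorem continuous_conv (hG : IsDominatedKernel G b) (M : ℝ) :
    Continuous fun p : BoundedBy 𝔅 M × ℝ => ∫ s, G s (p.1.1 (p.2 - s)) := by
  have : FirstCountableTopology C(ℝ, 𝔅) := UniformSpace.firstCountableTopology _
  have : FirstCountableTopology (BoundedBy 𝔅 M) :=
    TopologicalSpace.Subtype.firstCountableTopology _
  exact continuous_of_dominated (bound := fun s => |b s| * M)
    (fun p => (hG.integrable_conv p.1 p.2).aestronglyMeasurable)
    (fun p => ae_of_all _ fun s => hG.norm_apply_le p.1 s (p.2 - s))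
    (hG.integrable.abs.mul_const M)
    (ae_of_all _ fun s => (G s).continuous.comp (by fun_prop))

/-- The convolution `g ↦ (t ↦ ∫ G(s) g(t - s) ds)` on functions bounded by `M`, as a continuous map
into the continuous functions on the line. -/
noncomputable def conv (hG : IsDominatedKernel G b) (M : ℝ) : C(BoundedBy 𝔅 M, C(ℝ, 𝔅)) :=
  ContinuousMap.curry ⟨_, hG.continuous_conv M⟩

theorem conv_apply (hG : IsDominatedKernel G b) (g : BoundedBy 𝔅 M) (t : ℝ) :
    hG.conv M g t = ∫ s, G s (g.1 (t - s)) := rfl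

theorem norm_conv_sub_le (hG : IsDominatedKernel G b) (g g' : BoundedBy 𝔅 M) {δ t t' : ℝ}
    (h : ∀ s, ‖g.1 (t - s) - g'.1 (t' - s)‖ ≤ δ) :
    ‖hG.conv M g t - hG.conv M g' t'‖ ≤ (∫ s, |b s|) * δ := by
  rw [conv_apply, conv_apply, ← integral_sub (hG.integrable_conv g t) (hG.integrable_conv g' t'),
    ← integral_mul_const]
  refine norm_integral_le_of_norm_le (hG.integrable.abs.mul_const δ) (ae_of_all _ fun s => ?_)
  rw [← map_sub]
  exact (hG.norm_le s _).trans (mul_le_mul (le_abs_self _) (h s) (norm_nonneg _) (abs_nonneg _))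

theorem norm_conv_le (hG : IsDominatedKernel G b) (g : BoundedBy 𝔅 M) (t : ℝ) :
    ‖hG.conv M g t‖ ≤ (∫ s, |b s|) * M := by
  rw [conv_apply, ← integral_mul_const]
  exact norm_integral_le_of_norm_le (hG.integrable.abs.mul_const M)
    (ae_of_all _ fun s => hG.norm_apply_le g s (t - s))

theorem tendsto_conv_sub (hG : IsDominatedKernel G b) (g g' : BoundedBy 𝔅 M)
    (h : Tendsto (fun t => g.1 t - g'.1 t) atTop (𝓝 0)) :
    Tendsto (fun t => hG.conv M g t - hG.conv M g' t) atTop (𝓝 0) := by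
  have h0 : (0 : 𝔅) = ∫ s, G s 0 := by simp
  rw [h0]
  refine (tendsto_integral_filter_of_dominated_convergence (fun s => |b s| * (M + M))
    (F := fun t s => G s (g.1 (t - s) - g'.1 (t - s))) (Eventually.of_forall fun t =>
      hG.aestronglyMeasurable _ (by fun_prop))
    (Eventually.of_forall fun t => ae_of_all _ fun s => ?_)
    (hG.integrable.abs.mul_const _) (ae_of_all _ fun s => ?_)).congr fun t => ?_
  · rw [map_sub, mul_add]
    exact norm_sub_le_of_le (hG.norm_apply_le g s _) (hG.norm_apply_le g' s _)
  · exact ((G s).continuous.tendsto 0).comp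
      (h.comp (tendsto_atTop_add_const_right _ (-s) tendsto_id))
  · simp only [map_sub]
    exact integral_sub (hG.integrable_conv g t) (hG.integrable_conv g' t)

theorem shift_conv (hG : IsDominatedKernel G b) (h : ℝ) (g : BoundedBy 𝔅 M) :
    shift h (hG.conv M g) = hG.conv M (g.shift h) := by
  ext t
  simp only [shift_apply, conv_apply, BoundedBy.shift, add_sub_assoc]

theorem isLagrangeStable_conv (hG : IsDominatedKernel G b) (g : BoundedBy 𝔅 M)
    (h : IsLagrangeStable g.1) : IsLagrangeStable (hG.conv M g) := by
  have hclosed : IsClosed {g : C(ℝ, 𝔅) | ∀ t, ‖g t‖ ≤ M} := by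
    simp only [ofPred_forall]
    exact isClosed_iInter fun t => isClosed_le (by fun_prop) continuous_const
  have hK : IsCompact ((↑) ⁻¹' closure (range fun τ : ℝ => shift τ g.1) : Set (BoundedBy 𝔅 M)) :=
    hclosed.isClosedEmbedding_subtypeVal.isCompact_preimage h
  refine (hK.image (hG.conv M).continuous).closure_of_subset ?_
  rintro _ ⟨τ, rfl⟩
  exact ⟨g.shift τ, subset_closure ⟨τ, rfl⟩, (hG.shift_conv τ g).symm⟩

theorem isRelativelyDense_conv (hG : IsDominatedKernel G b) (g : BoundedBy 𝔅 M)
    (h : ∀ V ∈ 𝓝 g.1, IsRelativelyDense {τ : ℝ≥0 | shift (τ : ℝ) g.1 ∈ V}) :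
    IsAlmostRecurrent (restrictHalf (hG.conv M g)) := by
  intro ε hε
  have hcont : Continuous fun g : BoundedBy 𝔅 M => restrictHalf (hG.conv M g) :=
    continuous_restrictHalf.comp (hG.conv M).continuous
  have hpre := hcont.continuousAt.preimage_mem_nhds (x := g)
    ((hasBasis_nhds_bebutovDist _).mem_of_mem hε)
  rw [nhds_subtype_eq_comap, mem_comap] at hpre
  obtain ⟨V, hV, hsub⟩ := hpre
  refine (h V hV).mono fun τ hτ => ?_
  have := hsub (a := g.shift τ) hτ
  rwa [mem_preimage, ← hG.shift_conv, ← shift_restrictHalf] at this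

theorem isLevitanAlmostPeriodic_conv (hG : IsDominatedKernel G b) (g : BoundedBy 𝔅 M)
    (h : IsLevitanAlmostPeriodic.{u, 0, w} g.1) :
    IsLevitanAlmostPeriodic.{u, 0, w} (hG.conv M g) := by
  obtain ⟨Y, i₁, i₂, ψ, hψ, h⟩ := h
  refine ⟨Y, i₁, i₂, ψ, hψ, fun ε hε => ?_⟩
  have hpre := (hG.conv M).continuous.continuousAt.preimage_mem_nhds (x := g)
    ((hasBasis_nhds_bebutovDist _).mem_of_mem hε)
  rw [nhds_subtype_eq_comap, mem_comap] at hpre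
  obtain ⟨V, hV, hsub⟩ := hpre
  obtain ⟨η, hη, hηV⟩ := (hasBasis_nhds_bebutovDist _).mem_iff.1 hV
  obtain ⟨δ, hδ, h⟩ := h η hη
  refine ⟨δ, hδ, fun τ hτ => ?_⟩
  have := hsub (a := g.shift τ) (hηV (h τ hτ))
  rwa [mem_preimage, ← hG.shift_conv] at this

end IsDominatedKernel

end Kernel

/-! ### The Green kernel of a hyperbolic semigroup -/

section Green

open MeasureTheory

variable {𝕜 : Type v} [RCLike 𝕜]
variable {𝔅 : Type u} [NormedAddCommGroup 𝔅] [NormedSpace 𝕜 𝔅]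

/-- Strong continuity gives joint continuity, since the operators are bounded on compact time
intervals by the uniform boundedness principle. -/
theorem continuous_uncurry_of_strongly_continuous [CompleteSpace 𝔅] {K : ℝ≥0 → 𝔅 →L[𝕜] 𝔅}
    (hK : ∀ x, Continuous fun t => K t x) : Continuous fun p : ℝ≥0 × 𝔅 => K p.1 p.2 := by
  rw [continuous_iff_continuousAt]
  rintro ⟨s₀, x₀⟩
  obtain ⟨C, hC⟩ := banach_steinhaus (g := fun t : Icc (0 : ℝ≥0) (s₀ + 1) => K t) fun x => by
    obtain ⟨C, hC⟩ := (isCompact_Icc (a := (0 : ℝ≥0)) (b := s₀ + 1)).exists_bound_of_continuousOn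
      (hK x).continuousOn
    exact ⟨C, fun t => hC t t.2⟩
  rw [ContinuousAt, tendsto_iff_norm_sub_tendsto_zero]
  have hlim : Tendsto (fun p : ℝ≥0 × 𝔅 => C * ‖p.2 - x₀‖ + ‖K p.1 x₀ - K s₀ x₀‖) (𝓝 (s₀, x₀))
      (𝓝 0) := by
    have hcont : Continuous fun p : ℝ≥0 × 𝔅 => C * ‖p.2 - x₀‖ + ‖K p.1 x₀ - K s₀ x₀‖ := by
      have := (hK x₀).comp (continuous_fst : Continuous (Prod.fst : ℝ≥0 × 𝔅 → ℝ≥0))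
      fun_prop
    simpa using hcont.tendsto (s₀, x₀)
  refine squeeze_zero' (Eventually.of_forall fun _ => norm_nonneg _) ?_ hlim
  filter_upwards [continuous_fst.tendsto (s₀, x₀) (Iic_mem_nhds (lt_add_one s₀))] with p hp
  calc ‖K p.1 p.2 - K s₀ x₀‖ = ‖K p.1 (p.2 - x₀) + (K p.1 x₀ - K s₀ x₀)‖ := by simp
    _ ≤ C * ‖p.2 - x₀‖ + ‖K p.1 x₀ - K s₀ x₀‖ :=
      norm_add_le_of_le ((K p.1).le_of_opNorm_le (hC ⟨p.1, zero_le, hp⟩) _) le_rfl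

variable {U : C0Semigroup 𝕜 𝔅} {P : 𝔅 →L[𝕜] 𝔅}

theorem C0Semigroup.op_add_apply (U : C0Semigroup 𝕜 𝔅) (s t : ℝ≥0) (x : 𝔅) :
    U.op (s + t) x = U.op s (U.op t x) := by
  rw [U.op_add]; rfl

namespace IsHyperbolic

theorem mem_range_iff (hP : IsHyperbolic U P) {x : 𝔅} :
    x ∈ range (ContinuousLinearMap.id 𝕜 𝔅 - P) ↔ P x = 0 := by
  constructor
  · rintro ⟨y, rfl⟩
    simp [hP.proj]
  · intro h
    exact ⟨x, by simp [h]⟩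

theorem proj_compl (hP : IsHyperbolic U P) (x : 𝔅) : P (x - P x) = 0 := by
  simp [hP.proj]

theorem eq_of_op_eq (hP : IsHyperbolic U P) (s : ℝ≥0) {x y : 𝔅} (hx : P x = 0) (hy : P y = 0)
    (h : U.op s x = U.op s y) : x = y :=
  (hP.bijOn s).injOn (hP.mem_range_iff.2 hx) (hP.mem_range_iff.2 hy) h

theorem unstableInverse_spec (hP : IsHyperbolic U P) (s : ℝ≥0) (x : 𝔅) :
    P (unstableInverse U (ContinuousLinearMap.id 𝕜 𝔅 - P) (-s) x) = 0 ∧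
      U.op s (unstableInverse U (ContinuousLinearMap.id 𝕜 𝔅 - P) (-s) x) = x - P x := by
  have h := Function.invFunOn_pos ((hP.bijOn s).surjOn ⟨x, rfl⟩)
  rw [hP.mem_range_iff] at h
  simpa [unstableInverse] using h

/-- The backward evolution `U_Q(-s)`, for `s ≥ 0`, as a bounded linear operator. -/
noncomputable def backward (hP : IsHyperbolic U P) (s : ℝ≥0) : 𝔅 →L[𝕜] 𝔅 :=
  LinearMap.mkContinuousOfExistsBound
    { toFun := unstableInverse U (ContinuousLinearMap.id 𝕜 𝔅 - P) (-s)
      map_add' := fun x y => hP.eq_of_op_eq s (hP.unstableInverse_spec s _).1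
        (by
          rw [map_add, (hP.unstableInverse_spec s x).1, (hP.unstableInverse_spec s y).1,
            add_zero])
        (by
          rw [map_add, (hP.unstableInverse_spec s _).2, (hP.unstableInverse_spec s x).2,
            (hP.unstableInverse_spec s y).2, map_add]
          abel)
      map_smul' := fun c x => hP.eq_of_op_eq s (hP.unstableInverse_spec s _).1
        (by simp [(hP.unstableInverse_spec s x).1])
        (by
          rw [RingHom.id_apply, map_smul, (hP.unstableInverse_spec s _).2,
            (hP.unstableInverse_spec s x).2, map_smul, smul_sub]) }
    (by
      -- The dichotomy estimate covers `s > 0` only; at `s = 0` the operator is `I - P`.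
      obtain ⟨N, ν, -, -, -, h⟩ := hP.dichotomy
      rcases eq_zero_or_pos s with rfl | hs
      · refine ⟨‖ContinuousLinearMap.id 𝕜 𝔅 - P‖, fun x => ?_⟩
        have h0 := (hP.unstableInverse_spec 0 x).2
        rw [U.op_zero, ContinuousLinearMap.id_apply] at h0
        refine (congrArg norm h0).le.trans ?_
        exact (ContinuousLinearMap.id 𝕜 𝔅 - P).le_opNorm x
      · exact ⟨N * Real.exp (ν * -s), h (-s) (by simpa using hs)⟩)

theorem proj_backward (hP : IsHyperbolic U P) (s : ℝ≥0) (x : 𝔅) : P (hP.backward s x) = 0 :=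
  (hP.unstableInverse_spec s x).1

theorem op_backward (hP : IsHyperbolic U P) (s : ℝ≥0) (x : 𝔅) :
    U.op s (hP.backward s x) = x - P x :=
  (hP.unstableInverse_spec s x).2

theorem proj_op_backward (hP : IsHyperbolic U P) (s t : ℝ≥0) (x : 𝔅) :
    P (U.op s (hP.backward t x)) = 0 := by
  rw [← hP.comm, hP.proj_backward, map_zero]

/-- The operators `U_Q(-s)` form a backward evolution, as `U(s)` is injective on `ker P`. -/
theorem op_backward_add (hP : IsHyperbolic U P) (s t : ℝ≥0) (x : 𝔅) :
    U.op t (hP.backward (s + t) x) = hP.backward s x := by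
  refine hP.eq_of_op_eq s (hP.proj_op_backward _ _ _) (hP.proj_backward _ _) ?_
  rw [← U.op_add_apply, hP.op_backward, hP.op_backward]

/-- On `[0, T]` the backward evolution is the forward evolution started from `U_Q(-T) x`. -/
theorem continuous_backward (hP : IsHyperbolic U P) (x : 𝔅) :
    Continuous fun s => hP.backward s x := by
  rw [continuous_iff_continuousAt]
  intro s₀
  have hc : Continuous fun s : ℝ≥0 => U.op (s₀ + 1 - s) (hP.backward (s₀ + 1) x) :=
    (U.continuous_orbit _).comp (by fun_prop)
  refine hc.continuousAt.congr ?_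
  filter_upwards [Iic_mem_nhds (lt_add_one s₀)] with s hs
  rw [mem_Iic] at hs
  rw [← hP.op_backward_add s (s₀ + 1 - s) x, add_tsub_cancel_of_le hs]

theorem exists_bound (hP : IsHyperbolic U P) : ∃ C ν : ℝ, 0 < C ∧ 0 < ν ∧
    (∀ (s : ℝ≥0) (x : 𝔅), ‖U.op s (P x)‖ ≤ C * Real.exp (-ν * s) * ‖x‖) ∧
    ∀ (s : ℝ≥0) (x : 𝔅), ‖hP.backward s x‖ ≤ C * Real.exp (-ν * s) * ‖x‖ := by
  obtain ⟨N, ν, hN, hν, h1, h2⟩ := hP.dichotomy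
  refine ⟨max N ‖ContinuousLinearMap.id 𝕜 𝔅 - P‖, ν, lt_max_of_lt_left hN, hν, fun s x =>
    (h1 s x).trans (by gcongr; exact le_max_left _ _), fun s x => ?_⟩
  rcases eq_zero_or_pos s with rfl | hs
  · have h0 := hP.op_backward 0 x
    rw [U.op_zero, ContinuousLinearMap.id_apply] at h0
    rw [h0, NNReal.coe_zero, mul_zero, Real.exp_zero, mul_one]
    exact (ContinuousLinearMap.id 𝕜 𝔅 - P).le_of_opNorm_le (le_max_right _ _) x
  · refine (h2 (-s) (by simpa using hs) x).trans ?_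
    rw [mul_neg, ← neg_mul]
    gcongr
    exact le_max_left _ _

/-- The Green kernel: `U(s) P` for `s ≥ 0` and `-U_Q(s)` for `s < 0`. -/
noncomputable def green (hP : IsHyperbolic U P) (s : ℝ) : 𝔅 →L[𝕜] 𝔅 :=
  if 0 ≤ s then (U.op s.toNNReal).comp P else -hP.backward (-s).toNNReal

theorem green_of_nonneg (hP : IsHyperbolic U P) {s : ℝ} (hs : 0 ≤ s) (x : 𝔅) :
    hP.green s x = U.op s.toNNReal (P x) := by
  rw [green, if_pos hs]; rfl

theorem green_of_neg (hP : IsHyperbolic U P) {s : ℝ} (hs : s < 0) (x : 𝔅) :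
    hP.green s x = -hP.backward (-s).toNNReal x := by
  rw [green, if_neg hs.not_ge]; rfl

theorem integrable_exp_neg_mul_abs {ν : ℝ} (hν : 0 < ν) :
    Integrable fun s : ℝ => Real.exp (-ν * |s|) := by
  rw [← integrableOn_univ, ← Iic_union_Ioi (a := (0 : ℝ))]
  refine IntegrableOn.union ?_ ?_
  · refine (integrableOn_exp_mul_Iic hν 0).congr_fun (fun s hs => ?_) measurableSet_Iic
    simp [abs_of_nonpos (mem_Iic.1 hs)]
  · refine (exp_neg_integrableOn_Ioi 0 hν).congr_fun (fun s hs => ?_) measurableSet_Ioi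
    simp [abs_of_pos (mem_Ioi.1 hs)]

theorem exists_isDominatedKernel_green [CompleteSpace 𝔅] (hP : IsHyperbolic U P) :
    ∃ b : ℝ → ℝ, IsDominatedKernel hP.green b := by
  obtain ⟨C, ν, hC, hν, h1, h2⟩ := hP.exists_bound
  refine ⟨fun s => C * Real.exp (-ν * |s|), (integrable_exp_neg_mul_abs hν).const_mul C,
    fun s x => ?_, fun u hu => ?_⟩
  · rcases le_or_gt 0 s with hs | hs
    · rw [hP.green_of_nonneg hs]
      simpa [hs, abs_of_nonneg hs] using h1 s.toNNReal x
    · rw [hP.green_of_neg hs, norm_neg]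
      simpa [hs.le, abs_of_neg hs] using h2 (-s).toNNReal x
  · have hc1 : Continuous fun s : ℝ => U.op s.toNNReal (P (u s)) :=
      (continuous_uncurry_of_strongly_continuous U.continuous_orbit).comp
        (continuous_real_toNNReal.prodMk (P.continuous.comp hu))
    have hc2 : Continuous fun s : ℝ => -hP.backward (-s).toNNReal (u s) :=
      ((continuous_uncurry_of_strongly_continuous hP.continuous_backward).comp
        ((continuous_real_toNNReal.comp continuous_neg).prodMk hu)).neg
    have heq : (fun s => hP.green s (u s)) = fun s : ℝ =>
        if 0 ≤ s then U.op s.toNNReal (P (u s)) else -hP.backward (-s).toNNReal (u s) := by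
      ext s
      rw [green]
      split_ifs <;> rfl
    rw [heq]
    exact (StronglyMeasurable.ite measurableSet_Ici hc1.stronglyMeasurable
      hc2.stronglyMeasurable).aestronglyMeasurable

/-- The jump of the Green kernel at `0` is the identity: `G(t - r) - U(t) G(-r)` vanishes for `r`
outside `(0, t]`, and there it is `U(t - r)(P + Q)`. -/
theorem green_sub (hP : IsHyperbolic U P) (t : ℝ≥0) (r : ℝ) (x : 𝔅) :
    hP.green (t - r) x - U.op t (hP.green (0 - r) x) =
      (Ioc (0 : ℝ) t).indicator (fun r => U.op (t - r : ℝ).toNNReal x) r := by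
  rcases le_or_gt r 0 with hr | hr
  · rw [indicator_of_notMem (by simp [hr]),
      hP.green_of_nonneg (sub_nonneg.2 (hr.trans t.coe_nonneg)), hP.green_of_nonneg (by linarith),
      ← U.op_add_apply, sub_eq_add_neg (t : ℝ), Real.toNNReal_add t.coe_nonneg (by linarith),
      Real.toNNReal_coe, zero_sub, sub_self]
  rw [hP.green_of_neg (by linarith : 0 - r < 0), map_neg, sub_neg_eq_add, zero_sub, neg_neg]
  rcases le_or_gt r t with hrt | hrt
  · have ht : t = (t - r : ℝ).toNNReal + r.toNNReal := by
      rw [← Real.toNNReal_add (by linarith) hr.le, sub_add_cancel, Real.toNNReal_coe]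
    have hU : U.op t (hP.backward r.toNNReal x) = U.op (t - r : ℝ).toNNReal (x - P x) := by
      conv_lhs => rw [ht, U.op_add_apply, hP.op_backward]
    rw [indicator_of_mem (mem_Ioc.2 ⟨hr, hrt⟩), hP.green_of_nonneg (by linarith), hU, map_sub]
    abel
  · have hr' : r.toNNReal = (-(t - r : ℝ)).toNNReal + t := by
      rw [← Real.toNNReal_coe (r := t), ← Real.toNNReal_add (by simp; linarith) t.coe_nonneg]
      simp
    rw [indicator_of_notMem (by simp [hrt]), hP.green_of_neg (by linarith), hr',
      hP.op_backward_add, neg_add_cancel]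

/-- The convolution with the Green kernel is a mild solution on the semi-axis. -/
theorem conv_green_eq [NormedSpace ℝ 𝔅] [IsScalarTower ℝ 𝕜 𝔅] [CompleteSpace 𝔅]
    (hP : IsHyperbolic U P) {b : ℝ → ℝ} (hG : IsDominatedKernel hP.green b) {M : ℝ}
    (g : BoundedBy 𝔅 M) (t : ℝ≥0) :
    hG.conv M g t = U.op t (hG.conv M g 0) +
      ∫ s in (0 : ℝ)..(t : ℝ), U.op (t - s : ℝ).toNNReal (g.1 s) := by
  have hint : ∀ a : ℝ, Integrable fun r => hP.green (a - r) (g.1 r) := fun a => by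
    simpa using (hG.integrable_conv g a).comp_sub_left a
  have hconv : ∀ a : ℝ, hG.conv M g a = ∫ r, hP.green (a - r) (g.1 r) := fun a => by
    rw [hG.conv_apply, ← integral_sub_left_eq_self _ volume a]
    simp
  rw [hconv, hconv, ← ContinuousLinearMap.integral_comp_comm _ (hint 0), ← sub_eq_iff_eq_add',
    ← integral_sub (hint t) ((U.op t).integrable_comp (hint 0)),
    intervalIntegral.integral_of_le t.coe_nonneg, ← integral_indicator measurableSet_Ioc]
  refine integral_congr_ae (ae_of_all _ fun r => ?_)
  simp only [hP.green_sub, indicator_apply]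

end IsHyperbolic

end Green

/-! ### The bounded solution and its asymptotic behaviour -/

section Solution

variable {𝕜 : Type v} [RCLike 𝕜]
variable {𝔅 : Type u} [NormedAddCommGroup 𝔅] [NormedSpace 𝕜 𝔅]
variable {U : C0Semigroup 𝕜 𝔅} {P : 𝔅 →L[𝕜] 𝔅}

theorem IsLagrangeStable.exists_norm_le {T : Type v} [AddCommMonoid T] [PseudoMetricSpace T]
    [ContinuousAdd T] {φ : C(T, 𝔅)} (h : IsLagrangeStable φ) : ∃ M, ∀ t, ‖φ t‖ ≤ M := by
  obtain ⟨K, hK, hφ⟩ := h.exists_isCompact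
  obtain ⟨M, hM⟩ := hK.isBounded.exists_norm_le
  exact ⟨M, fun t => hM _ (hφ t)⟩

/-- The extension of a Birkhoff recurrent function to the line, with the properties used below: it
is bounded and Lagrange stable, it is recurrent under translations to the right, and it inherits
almost periods. -/
theorem IsBirkhoffRecurrent.exists_bounded_extension [CompleteSpace 𝔅] {p : C(ℝ≥0, 𝔅)}
    (h : IsBirkhoffRecurrent p) : ∃ (M : ℝ) (g : BoundedBy 𝔅 M), restrictHalf g.1 = p ∧
      IsLagrangeStable g.1 ∧
      (∀ V ∈ 𝓝 g.1, IsRelativelyDense {τ : ℝ≥0 | shift (τ : ℝ) g.1 ∈ V}) ∧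
      ∀ (σ : ℝ≥0) (δ : ℝ), (∀ t, dist (p (t + σ)) (p t) ≤ δ) →
        ∀ t : ℝ, dist (g.1 (t + σ)) (g.1 t) ≤ δ := by
  obtain ⟨g, hg, hlag, F, hF, hFtop, hlim⟩ := h.exists_extension
  obtain ⟨M, hM⟩ := hlag.exists_norm_le
  exact ⟨M, ⟨g, hM⟩, hg, hlag, fun V hV => h.1.isRelativelyDense_extension hg hFtop hlim hV,
    fun σ δ hσ t => dist_extension_le hFtop hlim hσ t⟩

theorem IsHyperbolic.tendsto_op_proj (hP : IsHyperbolic U P) (x : 𝔅) :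
    Tendsto (fun t : ℝ≥0 => U.op t (P x)) atTop (𝓝 0) := by
  obtain ⟨C, ν, -, hν, h, -⟩ := hP.exists_bound
  refine squeeze_zero_norm (h · x) ?_
  have h1 : Tendsto (fun t : ℝ≥0 => -ν * (t : ℝ)) atTop atBot :=
    (NNReal.tendsto_coe_atTop.2 tendsto_id).const_mul_atTop_of_neg (neg_lt_zero.2 hν)
  simpa using ((Real.tendsto_exp_atBot.comp h1).const_mul C).mul_const ‖x‖

/-- A bounded orbit issuing from the unstable subspace is trivial. -/
theorem IsHyperbolic.eq_zero_of_bounded_orbit (hP : IsHyperbolic U P) {x : 𝔅} (hx : P x = 0)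
    {M : ℝ} (hM : ∀ t, ‖U.op t x‖ ≤ M) : x = 0 := by
  obtain ⟨C, ν, hC, hν, -, h⟩ := hP.exists_bound
  have hback : ∀ t, hP.backward t (U.op t x) = x := fun t => by
    refine hP.eq_of_op_eq t (hP.proj_backward _ _) hx ?_
    rw [hP.op_backward, ← hP.comm, hx, map_zero, sub_zero]
  have h1 : Tendsto (fun t : ℝ≥0 => -ν * (t : ℝ)) atTop atBot :=
    (NNReal.tendsto_coe_atTop.2 tendsto_id).const_mul_atTop_of_neg (neg_lt_zero.2 hν)
  have h2 : Tendsto (fun t : ℝ≥0 => C * Real.exp (-ν * t) * M) atTop (𝓝 0) := by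
    simpa using ((Real.tendsto_exp_atBot.comp h1).const_mul C).mul_const M
  refine norm_le_zero_iff.1 (ge_of_tendsto' h2 fun t => ?_)
  calc ‖x‖ = ‖hP.backward t (U.op t x)‖ := by rw [hback]
    _ ≤ C * Real.exp (-ν * t) * ‖U.op t x‖ := h _ _
    _ ≤ C * Real.exp (-ν * t) * M := by gcongr; exact hM t

/-- The extension of a bounded continuous function on the semi-axis to the line. -/
noncomputable def extendBounded (f : ℝ≥0 →ᵇ 𝔅) : BoundedBy 𝔅 ‖f‖ :=
  ⟨extendHalf f.toContinuousMap, fun _ => f.norm_coe_le_norm _⟩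

variable [NormedSpace ℝ 𝔅] {b : ℝ → ℝ}

/-- The bounded solution on the semi-axis: the convolution of the extended forcing term with the
Green kernel, corrected by an orbit in the stable subspace so that its initial value has no stable
component. -/
noncomputable def IsHyperbolic.solution (hP : IsHyperbolic U P)
    (hG : IsDominatedKernel hP.green b) (f : ℝ≥0 →ᵇ 𝔅) : ℝ≥0 →ᵇ 𝔅 :=
  BoundedContinuousFunction.ofNormedAddCommGroup
    (fun t => hG.conv ‖f‖ (extendBounded f) t - U.op t (P (hG.conv ‖f‖ (extendBounded f) 0)))
    (((hG.conv ‖f‖ (extendBounded f)).continuous.comp NNReal.continuous_coe).sub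
      (U.continuous_orbit _))
    ((∫ s, |b s|) * ‖f‖ + hP.exists_bound.choose * ‖hG.conv ‖f‖ (extendBounded f) 0‖) (by
      intro t
      obtain ⟨ν, hC, hν, h, -⟩ := hP.exists_bound.choose_spec
      refine norm_sub_le_of_le (hG.norm_conv_le _ _) ((h t _).trans ?_)
      refine mul_le_mul_of_nonneg_right (mul_le_of_le_one_right hC.le ?_) (norm_nonneg _)
      exact Real.exp_le_one_iff.2 (by nlinarith [t.coe_nonneg]))

namespace IsHyperbolic

theorem solution_apply (hP : IsHyperbolic U P) (hG : IsDominatedKernel hP.green b)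
    (f : ℝ≥0 →ᵇ 𝔅) (t : ℝ≥0) : hP.solution hG f t =
      hG.conv ‖f‖ (extendBounded f) t - U.op t (P (hG.conv ‖f‖ (extendBounded f) 0)) := rfl

theorem solution_zero (hP : IsHyperbolic U P) (hG : IsDominatedKernel hP.green b)
    (f : ℝ≥0 →ᵇ 𝔅) : hP.solution hG f 0 =
      hG.conv ‖f‖ (extendBounded f) 0 - P (hG.conv ‖f‖ (extendBounded f) 0) := by
  rw [solution_apply, U.op_zero]; rfl

theorem isMildSolution_solution [CompleteSpace 𝔅] [IsScalarTower ℝ 𝕜 𝔅] (hP : IsHyperbolic U P)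
    (hG : IsDominatedKernel hP.green b) (f : ℝ≥0 →ᵇ 𝔅) :
    IsMildSolution U f.toContinuousMap (hP.solution hG f).toContinuousMap := by
  intro t
  change hP.solution hG f t = U.op t (hP.solution hG f 0) +
    ∫ s in (0 : ℝ)..(t : ℝ), U.op (t - s : ℝ).toNNReal ((extendBounded f).1 s)
  rw [solution_apply, solution_zero, hP.conv_green_eq hG, map_sub]
  abel

theorem eq_of_isMildSolution (hP : IsHyperbolic U P) {f φ ψ : ℝ≥0 →ᵇ 𝔅}
    (hφ : IsMildSolution U f.toContinuousMap φ.toContinuousMap) (hφ0 : P (φ 0) = 0)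
    (hψ : IsMildSolution U f.toContinuousMap ψ.toContinuousMap) (hψ0 : P (ψ 0) = 0) : ψ = φ := by
  have hdiff : ∀ t, ψ t - φ t = U.op t (ψ 0 - φ 0) := fun t => by
    have h1 := hψ t
    have h2 := hφ t
    simp only [BoundedContinuousFunction.coe_toContinuousMap] at h1 h2
    rw [h1, h2, map_sub]
    abel
  have h0 : ψ 0 - φ 0 = 0 := hP.eq_zero_of_bounded_orbit (by rw [map_sub, hψ0, hφ0, sub_zero])
    (M := ‖ψ - φ‖) fun t => by rw [← hdiff]; exact (ψ - φ).norm_coe_le_norm t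
  ext t
  rw [← sub_eq_zero, hdiff, h0, map_zero]

/-- A forcing term asymptotic to `g` has its bounded solution asymptotic to the solution on the line
with forcing term `g`. -/
theorem tendsto_dist_solution (hP : IsHyperbolic U P) (hG : IsDominatedKernel hP.green b)
    (f : ℝ≥0 →ᵇ 𝔅) {M : ℝ} (g : BoundedBy 𝔅 M)
    (h : Tendsto (fun t : ℝ≥0 => dist (f t) (g.1 t)) atTop (𝓝 0)) :
    Tendsto (fun t : ℝ≥0 => dist (hP.solution hG f t) (hG.conv M g t)) atTop (𝓝 0) := by
  let f' : BoundedBy 𝔅 (max ‖f‖ M) :=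
    ⟨(extendBounded f).1, fun t => ((extendBounded f).2 t).trans (le_max_left _ _)⟩
  let g' : BoundedBy 𝔅 (max ‖f‖ M) := ⟨g.1, fun t => (g.2 t).trans (le_max_right _ _)⟩
  have h1 : Tendsto (fun t : ℝ => f'.1 t - g'.1 t) atTop (𝓝 0) := by
    rw [tendsto_zero_iff_norm_tendsto_zero]
    refine (h.comp Real.tendsto_toNNReal_atTop).congr' ?_
    filter_upwards [eventually_ge_atTop 0] with t ht
    rw [Function.comp_apply, dist_eq_norm, Real.coe_toNNReal t ht]
    rfl
  have h2 := ((hG.tendsto_conv_sub f' g' h1).comp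
    (NNReal.tendsto_coe_atTop.2 tendsto_id)).sub
      (hP.tendsto_op_proj (hG.conv ‖f‖ (extendBounded f) 0))
  rw [sub_zero, tendsto_zero_iff_norm_tendsto_zero] at h2
  refine h2.congr fun t => ?_
  rw [dist_eq_norm, solution_apply, sub_right_comm]
  rfl

theorem isLagrangeStable_solution [CompleteSpace 𝔅] (hP : IsHyperbolic U P)
    (hG : IsDominatedKernel hP.green b)
    (f : ℝ≥0 →ᵇ 𝔅) (h : IsLagrangeStable f.toContinuousMap) :
    IsLagrangeStable (hP.solution hG f).toContinuousMap := by
  have h1 : IsLagrangeStable (restrictHalf (hG.conv ‖f‖ (extendBounded f))) :=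
    (hG.isLagrangeStable_conv (extendBounded f) h.extendHalf).restrictHalf
  let orbit : C(𝔅, C(ℝ≥0, 𝔅)) := ContinuousMap.curry ⟨fun p : 𝔅 × ℝ≥0 => U.op p.2 (P p.1),
    (continuous_uncurry_of_strongly_continuous U.continuous_orbit).comp
      (continuous_snd.prodMk (P.continuous.comp continuous_fst))⟩
  have h2 : IsCompact (insert 0
      (range fun t => U.op t (P (hG.conv ‖f‖ (extendBounded f) 0)))) := by
    refine Tendsto.isCompact_insert_range_of_cocompact ?_ (U.continuous_orbit _)
    exact (hP.tendsto_op_proj _).mono_left cocompact_le_atTop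
  -- A translate of the solution is a translate of the convolution minus an orbit in the stable
  -- subspace, whose starting points form a relatively compact set.
  refine ((h1.prod (h2.image orbit.continuous)).image continuous_sub).closure_of_subset ?_
  rintro _ ⟨τ, rfl⟩
  refine ⟨(_, _), ⟨subset_closure ⟨τ, rfl⟩, _, mem_insert_of_mem _ ⟨τ, rfl⟩, rfl⟩, ?_⟩
  ext t
  change hG.conv ‖f‖ (extendBounded f) ((τ + t : ℝ≥0) : ℝ) -
    U.op t (P (U.op τ (P (hG.conv ‖f‖ (extendBounded f) 0)))) = hP.solution hG f (τ + t)
  rw [solution_apply, ← hP.comm, hP.proj, add_comm τ t, U.op_add_apply]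

theorem asymptotically_isStationary_solution (hP : IsHyperbolic U P)
    (hG : IsDominatedKernel hP.green b) (f : ℝ≥0 →ᵇ 𝔅)
    (h : Asymptotically IsStationary f.toContinuousMap) :
    Asymptotically IsStationary (hP.solution hG f).toContinuousMap := by
  obtain ⟨p, hp, hlim⟩ := h
  let g : BoundedBy 𝔅 ‖p 0‖ := ⟨ContinuousMap.const ℝ (p 0), fun _ => le_rfl⟩
  exact ⟨restrictHalf (hG.conv _ g), fun t => rfl, hP.tendsto_dist_solution hG f g
    (hlim.congr fun t => by rw [hp t]; rfl)⟩

theorem asymptotically_isPeriodic_solution [CompleteSpace 𝔅] (hP : IsHyperbolic U P)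
    (hG : IsDominatedKernel hP.green b) (f : ℝ≥0 →ᵇ 𝔅) (τ : ℝ≥0)
    (h : Asymptotically (IsPeriodic τ) f.toContinuousMap) :
    Asymptotically (IsPeriodic τ) (hP.solution hG f).toContinuousMap := by
  -- Every function is `0`-periodic.
  rcases eq_zero_or_pos τ with rfl | hτ
  · exact ⟨(hP.solution hG f).toContinuousMap, fun t => by rw [add_zero], by simp⟩
  obtain ⟨p, hp, hlim⟩ := h
  obtain ⟨M, g, rfl, -, -, hper⟩ :=
    (hp.isBohrAlmostPeriodic hτ).isBirkhoffRecurrent.exists_bounded_extension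
  refine ⟨restrictHalf (hG.conv M g), fun t => ?_, hP.tendsto_dist_solution hG f g hlim⟩
  have := hG.norm_conv_sub_le g g (δ := 0) (t := t + τ) (t' := t) fun s => by
    rw [add_sub_right_comm, ← dist_eq_norm]
    exact hper τ 0 (fun r => (dist_eq_zero.2 (hp r)).le) (t - s)
  rw [mul_zero, norm_le_zero_iff, sub_eq_zero] at this
  simpa using this

theorem asymptotically_isBohrAlmostPeriodic_solution [CompleteSpace 𝔅] (hP : IsHyperbolic U P)
    (hG : IsDominatedKernel hP.green b) (f : ℝ≥0 →ᵇ 𝔅)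
    (h : Asymptotically IsBohrAlmostPeriodic f.toContinuousMap) :
    Asymptotically IsBohrAlmostPeriodic (hP.solution hG f).toContinuousMap := by
  obtain ⟨p, hp, hlim⟩ := h
  obtain ⟨M, g, rfl, -, -, hper⟩ := hp.isBirkhoffRecurrent.exists_bounded_extension
  refine ⟨restrictHalf (hG.conv M g), fun ε hε => ?_, hP.tendsto_dist_solution hG f g hlim⟩
  have hI : 0 ≤ ∫ s, |b s| := MeasureTheory.integral_nonneg fun s => abs_nonneg _
  refine (hp (ε / ((∫ s, |b s|) + 1)) (by positivity)).mono fun σ hσ t => ?_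
  have := hG.norm_conv_sub_le g g (δ := ε / ((∫ s, |b s|) + 1)) (t := t + σ) (t' := t) fun s => by
    rw [add_sub_right_comm, ← dist_eq_norm]
    exact hper σ _ (fun r => (hσ r).le) (t - s)
  rw [dist_eq_norm]
  refine (lt_of_le_of_lt (by simpa using this) ?_ : _ < ε)
  rw [mul_div_assoc', div_lt_iff₀ (by positivity)]
  linarith

theorem asymptotically_isBirkhoffRecurrent_solution [CompleteSpace 𝔅] (hP : IsHyperbolic U P)
    (hG : IsDominatedKernel hP.green b) (f : ℝ≥0 →ᵇ 𝔅)
    (h : Asymptotically IsBirkhoffRecurrent f.toContinuousMap) :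
    Asymptotically IsBirkhoffRecurrent (hP.solution hG f).toContinuousMap := by
  obtain ⟨p, hp, hlim⟩ := h
  obtain ⟨M, g, rfl, hlag, hrec, -⟩ := hp.exists_bounded_extension
  exact ⟨restrictHalf (hG.conv M g), ⟨hG.isRelativelyDense_conv g hrec,
    (hG.isLagrangeStable_conv g hlag).restrictHalf⟩, hP.tendsto_dist_solution hG f g hlim⟩

theorem isAsymptoticallyAlmostAutomorphic_solution (hP : IsHyperbolic U P)
    (hG : IsDominatedKernel hP.green b) (f : ℝ≥0 →ᵇ 𝔅)
    (h : IsAsymptoticallyAlmostAutomorphic.{u, w} f.toContinuousMap) :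
    IsAsymptoticallyAlmostAutomorphic.{u, w} (hP.solution hG f).toContinuousMap := by
  obtain ⟨p, ⟨hlev, hlag⟩, hlim⟩ := h
  obtain ⟨M, hM⟩ := hlag.exists_norm_le
  exact ⟨hG.conv M ⟨p, hM⟩, ⟨hG.isLevitanAlmostPeriodic_conv _ hlev,
    hG.isLagrangeStable_conv _ hlag⟩, hP.tendsto_dist_solution hG f ⟨p, hM⟩ hlim⟩

end IsHyperbolic

/-- A continuous function periodic in each variable takes all its values on the compact cube
`[0, 2π]^k`. -/
theorem exists_isCompact_of_periodic {X : Type u} [TopologicalSpace X] {k : ℕ}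
    {Φ : (Fin k → ℝ) → X} (hΦ : Continuous Φ)
    (hper : ∀ (θ : Fin k → ℝ) (i : Fin k), Φ (Function.update θ i (θ i + 2 * Real.pi)) = Φ θ) :
    ∃ K, IsCompact K ∧ ∀ θ, Φ θ ∈ K := by
  have hpi : ∀ (θ : Fin k → ℝ) (i : Fin k) (n : ℤ),
      Φ (Function.update θ i (θ i - n • (2 * Real.pi))) = Φ θ := by
    intro θ i n
    have hp : Function.Periodic (fun r => Φ (Function.update θ i r)) (2 * Real.pi) := fun r => by
      simpa using hper (Function.update θ i r) i
    simpa using hp.sub_zsmul_eq n (x := θ i)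
  have hmod : ∀ (θ : Fin k → ℝ) (S : Finset (Fin k)),
      Φ (fun i => if i ∈ S then toIcoMod Real.two_pi_pos 0 (θ i) else θ i) = Φ θ := by
    intro θ S
    induction S using Finset.induction_on with
    | empty => simp
    | insert a S ha ih =>
      rw [← ih, ← hpi (fun i => if i ∈ S then toIcoMod Real.two_pi_pos 0 (θ i) else θ i) a
        (toIcoDiv Real.two_pi_pos 0 (θ a))]
      congr 1
      ext i
      by_cases hia : i = a
      · subst hia
        simp only [Finset.mem_insert_self, if_true, Function.update_self, ha, if_false]
        rfl
      · simp [hia]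
  refine ⟨_, (isCompact_univ_pi fun _ : Fin k => isCompact_Icc (a := 0)
    (b := 2 * Real.pi)).image hΦ, fun θ => ⟨_, fun i _ => ?_, hmod θ Finset.univ⟩⟩
  have := toIcoMod_mem_Ico Real.two_pi_pos 0 (θ i)
  rw [zero_add] at this
  simpa using Ico_subset_Icc_self this

theorem IsHyperbolic.asymptotically_isQuasiPeriodic_solution (hP : IsHyperbolic U P)
    (hG : IsDominatedKernel hP.green b) (f : ℝ≥0 →ᵇ 𝔅) {k : ℕ} (ν : Fin k → ℝ)
    (h : Asymptotically (IsQuasiPeriodic ν) f.toContinuousMap) :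
    Asymptotically (IsQuasiPeriodic ν) (hP.solution hG f).toContinuousMap := by
  obtain ⟨p, ⟨hν, Φ, hΦ, hper, hp⟩, hlim⟩ := h
  obtain ⟨K, hK, hΦK⟩ := exists_isCompact_of_periodic hΦ hper
  obtain ⟨M, hM⟩ := hK.isBounded.exists_norm_le
  -- The forcing term on the line started from the phase `θ` on the torus.
  let line : C(Fin k → ℝ, C(ℝ, 𝔅)) := ContinuousMap.curry
    ⟨fun q : (Fin k → ℝ) × ℝ => Φ (q.1 + q.2 • ν), hΦ.comp (by fun_prop)⟩
  let g : (Fin k → ℝ) → BoundedBy 𝔅 M := fun θ => ⟨line θ, fun t => hM _ (hΦK _)⟩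
  have hg : Continuous g := line.continuous.subtype_mk _
  refine ⟨restrictHalf (hG.conv M (g 0)), ⟨hν, fun θ => hG.conv M (g θ) 0, ?_, fun θ i => ?_,
    fun t => ?_⟩, hP.tendsto_dist_solution hG f (g 0) (hlim.congr fun t => ?_)⟩
  · exact (continuous_eval_const (0 : ℝ)).comp ((hG.conv M).continuous.comp hg)
  · have : g (Function.update θ i (θ i + 2 * Real.pi)) = g θ := by
      ext t
      change Φ (Function.update θ i (θ i + 2 * Real.pi) + t • ν) = Φ (θ + t • ν)
      rw [← hper (θ + t • ν) i]
      congr 1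
      ext j
      by_cases hj : j = i
      · subst hj
        simp only [Pi.add_apply, Function.update_self]
        ring
      · simp [hj]
    exact congrArg (fun g => hG.conv M g 0) this
  · have h1 : (g 0).shift (t : ℝ) = g fun i => ν i * (t : ℝ) := by
      ext s
      change Φ (0 + ((t : ℝ) + s) • ν) = Φ ((fun i => ν i * (t : ℝ)) + s • ν)
      congr 1
      ext j
      simp only [Pi.add_apply, Pi.zero_apply, Pi.smul_apply, smul_eq_mul]
      ring
    change hG.conv M (g 0) t = hG.conv M (g fun i => ν i * (t : ℝ)) 0
    rw [← h1, ← hG.shift_conv, shift_apply, add_zero]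
  · rw [hp t]
    congr 2
    ext i
    simp [mul_comm]

end Solution

end AsymptoticRecurrence

theorem mainTheorem5
    {𝕜 : Type v} [RCLike 𝕜]
    {𝔅 : Type u} [NormedAddCommGroup 𝔅] [NormedSpace ℝ 𝔅] [NormedSpace 𝕜 𝔅]
    [IsScalarTower ℝ 𝕜 𝔅] [CompleteSpace 𝔅]
    (A : 𝔅 →ₗ.[𝕜] 𝔅) (U : AsymptoticRecurrence.C0Semigroup 𝕜 𝔅)
    (hA : AsymptoticRecurrence.IsGenerator A U)
    (P : 𝔅 →L[𝕜] 𝔅) (hP : AsymptoticRecurrence.IsHyperbolic U P)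
    (f : ℝ≥0 →ᵇ 𝔅) :
    ∃ φ : ℝ≥0 →ᵇ 𝔅,
      (AsymptoticRecurrence.IsMildSolution U f.toContinuousMap φ.toContinuousMap ∧ P (φ 0) = 0) ∧
      (∀ ψ : ℝ≥0 →ᵇ 𝔅,
        AsymptoticRecurrence.IsMildSolution U f.toContinuousMap ψ.toContinuousMap →
          P (ψ 0) = 0 → ψ = φ) ∧
      (AsymptoticRecurrence.Asymptotically AsymptoticRecurrence.IsStationary f.toContinuousMap →
        AsymptoticRecurrence.Asymptotically AsymptoticRecurrence.IsStationary φ.toContinuousMap) ∧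
      (∀ τ : ℝ≥0,
        AsymptoticRecurrence.Asymptotically (AsymptoticRecurrence.IsPeriodic τ)
            f.toContinuousMap →
          AsymptoticRecurrence.Asymptotically (AsymptoticRecurrence.IsPeriodic τ)
            φ.toContinuousMap) ∧
      (∀ (k : ℕ) (ν : Fin k → ℝ),
        AsymptoticRecurrence.Asymptotically (AsymptoticRecurrence.IsQuasiPeriodic ν)
            f.toContinuousMap →
          AsymptoticRecurrence.Asymptotically (AsymptoticRecurrence.IsQuasiPeriodic ν)
            φ.toContinuousMap) ∧
      (AsymptoticRecurrence.Asymptotically AsymptoticRecurrence.IsBohrAlmostPeriodic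
          f.toContinuousMap →
        AsymptoticRecurrence.Asymptotically AsymptoticRecurrence.IsBohrAlmostPeriodic
          φ.toContinuousMap) ∧
      (AsymptoticRecurrence.IsAsymptoticallyAlmostAutomorphic.{u, w} f.toContinuousMap →
        AsymptoticRecurrence.IsAsymptoticallyAlmostAutomorphic.{u, w} φ.toContinuousMap) ∧
      (AsymptoticRecurrence.Asymptotically AsymptoticRecurrence.IsBirkhoffRecurrent
          f.toContinuousMap →
        AsymptoticRecurrence.Asymptotically AsymptoticRecurrence.IsBirkhoffRecurrent
          φ.toContinuousMap) ∧
      (AsymptoticRecurrence.IsLagrangeStable f.toContinuousMap →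
        AsymptoticRecurrence.IsLagrangeStable φ.toContinuousMap) := by
  obtain ⟨b, hG⟩ := hP.exists_isDominatedKernel_green
  have hmild := hP.isMildSolution_solution hG f
  have hinit : P (hP.solution hG f 0) = 0 := by rw [hP.solution_zero, hP.proj_compl]
  exact ⟨hP.solution hG f, ⟨hmild, hinit⟩,
    fun ψ hψ hψ0 => hP.eq_of_isMildSolution hmild hinit hψ hψ0,
    hP.asymptotically_isStationary_solution hG f,
    hP.asymptotically_isPeriodic_solution hG f,
    fun _ ν => hP.asymptotically_isQuasiPeriodic_solution hG f ν,
    hP.asymptotically_isBohrAlmostPeriodic_solution hG f,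
    hP.isAsymptoticallyAlmostAutomorphic_solution hG f,
    hP.asymptotically_isBirkhoffRecurrent_solution hG f,
    hP.isLagrangeStable_solution hG f⟩
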